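/- Let $M$ be a smooth manifold of dimension $2n+1$. A \emph{contact metric structure} $(\eta,\xi,\phi,g)$ on $M$ consists of a one-form $\eta$ with $\eta\wedge(d\eta)^n\neq 0$ everywhere, a vector field $\xi$, an endomorphism field $\phi$ of $TM$ and a Riemannian metric $g$ (all smooth) such that $$\eta(\xi)=1,\quad g(\xi,\xi)=1,\quad \phi^2=-\mathrm{Id}+\eta\otimes\xi,\quad \phi\xi=0,\quad d\eta(X,Y)=2g(X,\phi Y),$$ where $d\eta(X,Y)=X\eta(Y)-Y\eta(X)-\eta([X,Y])$. Put $h=\tfrac12 L_\xi\phi$; the structure is \emph{K-contact} if $h$ vanishes identically. For real constants $\kappa,\mu$ it is a \emph{weakly $(\kappa,\mu)$-structure} if $$R(X,\xi)\xi=\kappa\,(X-\eta(X)\xi)+\mu\,hX$$ for all $X$, where $R(X,Y)Z=\nabla_X\nabla_YZ-\nabla_Y\nabla_XZ-\nabla_{[X,Y]}Z$ is the curvature of the Levi-Civita connection of $g$. Its Boeckx invariant is $I_M=\dfrac{1-\mu/2}{\sqrt{1-\kappa}}$ (a weakly $(\kappa,\mu)$-structure that is not K-contact has $\kappa<1$).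 \textbf{Theorem.} Let $(\eta,\xi,\phi,g)$ be a weakly $(\kappa,\mu)$ contact metric structure on $M$ that is not K-contact and satisfies $|I_M|<1$. Then there are an endomorphism field $\phi_1$ and a Riemannian metric $g_1$ on $M$ such that $(\eta,\xi,\phi_1,g_1)$ is a contact metric structure with the same contact form $\eta$ and Reeb field $\xi$, with $$\phi_1=\frac{1}{2\sqrt{1-\kappa}\,\sqrt{1-\kappa-(1-\frac{\mu}{2})^2}}\;L_\xi h ,$$ and it is a weakly $(\kappa_1,2)$-structure with $\kappa_1=\kappa+\left(1-\frac{\mu}{2}\right)^2$. -/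

import Mathlib

open Bundle VectorField
open scoped Manifold ContDiff

noncomputable section

section LeviCivita

variable {E : Type*} [NormedAddCommGroup E] [NormedSpace ℝ E]
  {H : Type*} [TopologicalSpace H] {I : ModelWithCorners ℝ E H}
  {M : Type*} [TopologicalSpace M] [ChartedSpace H M] [IsManifold I ∞ M]

/-- The function `x ↦ g(X, Y)(x)`. -/
def metricPair (g : ContMDiffRiemannianMetric I ∞ E (TangentSpace I : M → Type _))
    (X Y : Π x : M, TangentSpace I x) : M → ℝ :=
  fun x ↦ g.inner x (X x) (Y x)

/-- A connection on `TM` is a Levi-Civita connection of `g` if it is torsion-free and satisfies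
`X g(Y, Z) = g(∇_X Y, Z) + g(Y, ∇_X Z)`. Here `cov Y x (X x)` is `(∇_X Y)(x)`. -/
structure IsLeviCivita (g : ContMDiffRiemannianMetric I ∞ E (TangentSpace I : M → Type _))
    (cov : CovariantDerivative I E (TangentSpace I : M → Type _)) : Prop where
  torsion_free : ∀ {X Y : Π x : M, TangentSpace I x} {x : M},
    MDiffAt (T% X) x → MDiffAt (T% Y) x →
      cov Y x (X x) - cov X x (Y x) = mlieBracket I X Y x
  metric : ∀ {X Y Z : Π x : M, TangentSpace I x} {x : M},
    MDiffAt (T% X) x → MDiffAt (T% Y) x → MDiffAt (T% Z) x →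
      mvfderiv I (metricPair g Y Z) x (X x)
        = g.inner x (cov Y x (X x)) (Z x) + g.inner x (Y x) (cov Z x (X x))

variable (g : ContMDiffRiemannianMetric I ∞ E (TangentSpace I : M → Type _))
  {X X' Y Y' Z : Π x : M, TangentSpace I x} {x : M} {f : M → ℝ}

lemma mdifferentiableAt_metricPair (hX : MDiffAt (T% X) x) (hY : MDiffAt (T% Y) x) :
    MDiffAt (metricPair g X Y) x := by
  have : MDifferentiableAt I (I.prod 𝓘(ℝ))
      (fun m ↦ TotalSpace.mk' ℝ (E := Bundle.Trivial M ℝ) m (g.inner m (X m) (Y m))) x := by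
    apply MDifferentiableAt.clm_bundle_apply₂ (F₁ := E) (F₂ := E)
    · exact g.contMDiff.mdifferentiableAt (by simp)
    · exact hX
    · exact hY
  simp only [mdifferentiableAt_totalSpace] at this
  exact this.2

lemma metricPair_comm : metricPair g X Y = metricPair g Y X := by
  ext x; exact g.symm _ _ _

lemma metricPair_add_left : metricPair g (X + X') Y = metricPair g X Y + metricPair g X' Y := by
  ext x; simp [metricPair]

lemma metricPair_add_right : metricPair g Y (X + X') = metricPair g Y X + metricPair g Y X' := by
  ext x; simp [metricPair]

lemma metricPair_smul_left : metricPair g (f • X) Y = f * metricPair g X Y := by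
  ext x; simp [metricPair]

lemma metricPair_smul_right : metricPair g Y (f • X) = f * metricPair g Y X := by
  ext x; simp [metricPair]

/-- The right-hand side of the Koszul formula. -/
def koszul (Y X Z : Π x : M, TangentSpace I x) (x : M) : ℝ :=
  (1 / 2 : ℝ) * (mvfderiv I (metricPair g Y Z) x (X x) + mvfderiv I (metricPair g X Z) x (Y x)
    - mvfderiv I (metricPair g X Y) x (Z x) + g.inner x (mlieBracket I X Y x) (Z x)
    - g.inner x (mlieBracket I X Z x) (Y x) - g.inner x (mlieBracket I Y Z x) (X x))

lemma ext_inner {u v : TangentSpace I x} (h : ∀ w, g.inner x u w = g.inner x v w) : u = v := by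
  by_contra hne
  have h1 := g.pos x (u - v) (sub_ne_zero.mpr hne)
  have h2 : g.inner x (u - v) (u - v) = 0 := by simp [h]
  exact absurd h2 h1.ne'

lemma eq_of_forall_field {A B : TangentSpace I x →L[ℝ] TangentSpace I x}
    (h : ∀ X Z : Π x : M, TangentSpace I x, MDiffAt (T% X) x → MDiffAt (T% Z) x →
      g.inner x (A (X x)) (Z x) = g.inner x (B (X x)) (Z x)) : A = B := by
  ext u
  refine ext_inner g fun w ↦ ?_
  have := h (FiberBundle.extend E u) (FiberBundle.extend E w)
    (FiberBundle.mdifferentiableAt_extend ..) (FiberBundle.mdifferentiableAt_extend ..)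
  simpa using this

/-- Uniqueness of the Levi-Civita connection, on fields differentiable at the point. -/
theorem IsLeviCivita.unique {cov cov' : CovariantDerivative I E (TangentSpace I : M → Type _)}
    (h : IsLeviCivita g cov) (h' : IsLeviCivita g cov') (hY : MDiffAt (T% Y) x) :
    cov Y x = cov' Y x := by
  have key : ∀ {c : CovariantDerivative I E (TangentSpace I : M → Type _)}, IsLeviCivita g c →
      ∀ X Z : Π x : M, TangentSpace I x, MDiffAt (T% X) x → MDiffAt (T% Z) x →
        g.inner x (c Y x (X x)) (Z x) = koszul g Y X Z x := by
    intro c hc X Z hX hZ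
    rw [koszul, ← hc.torsion_free hX hY, ← hc.torsion_free hX hZ, ← hc.torsion_free hY hZ,
      hc.metric hX hY hZ, hc.metric hY hX hZ, hc.metric hZ hX hY]
    simp only [map_sub, sub_apply, g.symm x (X x), g.symm x (Y x)]
    ring
  exact eq_of_forall_field g fun X Z hX hZ ↦ by rw [key h X Z hX hZ, key h' X Z hX hZ]

variable [FiniteDimensional ℝ E]

lemma koszul_add_field (hY : MDiffAt (T% Y) x) (hY' : MDiffAt (T% Y') x)
    (hX : MDiffAt (T% X) x) (hZ : MDiffAt (T% Z) x) :
    koszul g (Y + Y') X Z x = koszul g Y X Z x + koszul g Y' X Z x := by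
  have a := mdifferentiableAt_metricPair g hY hZ
  have a' := mdifferentiableAt_metricPair g hY' hZ
  have b := mdifferentiableAt_metricPair g hX hY
  have b' := mdifferentiableAt_metricPair g hX hY'
  simp [koszul, metricPair_add_left, metricPair_add_right, mvfderiv_add, a, a', b, b',
    mlieBracket_add_left hY hY', mlieBracket_add_right hY hY']
  ring

lemma koszul_smul_field (hf : MDiffAt f x) (hY : MDiffAt (T% Y) x)
    (hX : MDiffAt (T% X) x) (hZ : MDiffAt (T% Z) x) :
    koszul g (f • Y) X Z x
      = f x * koszul g Y X Z x + mvfderiv I f x (X x) * g.inner x (Y x) (Z x) := by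
  have a := mdifferentiableAt_metricPair g hY hZ
  have b := mdifferentiableAt_metricPair g hX hY
  simp [koszul, metricPair_smul_left, metricPair_smul_right, mvfderiv_mul, a, b, hf,
    mlieBracket_smul_left hf hY, mlieBracket_smul_right hf hY]
  simp only [metricPair, g.symm x (X x) (Y x)]
  ring

lemma koszul_tensorial_dir (hY : MDiffAt (T% Y) x) (hZ : MDiffAt (T% Z) x) :
    TensorialAt I E (fun X ↦ koszul g Y X Z x) x where
  smul {f X} hf hX := by
    have a := mdifferentiableAt_metricPair g hX hZ
    have b := mdifferentiableAt_metricPair g hX hY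
    simp [koszul, metricPair_smul_left, mvfderiv_mul, a, b, hf,
      mlieBracket_smul_left hf hX]
    simp only [metricPair]
    ring
  add {X X'} hX hX' := by
    have a := mdifferentiableAt_metricPair g hX hZ
    have a' := mdifferentiableAt_metricPair g hX' hZ
    have b := mdifferentiableAt_metricPair g hX hY
    have b' := mdifferentiableAt_metricPair g hX' hY
    simp [koszul, metricPair_add_left, mvfderiv_add, a, a', b, b',
      mlieBracket_add_left hX hX']
    ring

lemma koszul_tensorial_test (hY : MDiffAt (T% Y) x) (hX : MDiffAt (T% X) x) :
    TensorialAt I E (fun Z ↦ koszul g Y X Z x) x where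
  smul {f Z} hf hZ := by
    have a := mdifferentiableAt_metricPair g hY hZ
    have b := mdifferentiableAt_metricPair g hX hZ
    simp [koszul, metricPair_smul_right, mvfderiv_mul, a, b, hf,
      mlieBracket_smul_right hf hZ]
    simp only [metricPair, g.symm x (Z x) (Y x), g.symm x (Z x) (X x)]
    ring
  add {Z Z'} hZ hZ' := by
    have a := mdifferentiableAt_metricPair g hY hZ
    have a' := mdifferentiableAt_metricPair g hY hZ'
    have b := mdifferentiableAt_metricPair g hX hZ
    have b' := mdifferentiableAt_metricPair g hX hZ'
    simp [koszul, metricPair_add_right, mvfderiv_add, a, a', b, b',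
      mlieBracket_add_right hZ hZ']
    ring

lemma exists_inner_eq (x : M)
    (B : TangentSpace I x →L[ℝ] TangentSpace I x →L[ℝ] ℝ) :
    ∃ A : TangentSpace I x →L[ℝ] TangentSpace I x, ∀ u w, g.inner x (A u) w = B u w := by
  have : FiniteDimensional ℝ (TangentSpace I x) := inferInstanceAs (FiniteDimensional ℝ E)
  have : T2Space (TangentSpace I x) := inferInstanceAs (T2Space E)
  let flat : TangentSpace I x →ₗ[ℝ] Module.Dual ℝ (TangentSpace I x) :=
    { toFun := fun u ↦ (g.inner x u).toLinearMap
      map_add' := fun u v ↦ by ext; simp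
      map_smul' := fun c v ↦ by ext; simp }
  have hinj : Function.Injective flat := by
    rw [injective_iff_map_eq_zero]
    intro u hu
    by_contra hne
    have h1 := g.pos x u hne
    have h2 : g.inner x u u = 0 := by simpa [flat] using congrArg (fun l ↦ l u) hu
    exact absurd h2 h1.ne'
  let e := LinearEquiv.ofInjectiveOfFinrankEq flat hinj
    (Subspace.dual_finrank_eq (K := ℝ) (V := TangentSpace I x)).symm
  let Bl : TangentSpace I x →ₗ[ℝ] Module.Dual ℝ (TangentSpace I x) :=
    { toFun := fun u ↦ (B u).toLinearMap
      map_add' := fun u v ↦ by ext; simp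
      map_smul' := fun c v ↦ by ext; simp }
  refine ⟨LinearMap.toContinuousLinearMap (e.symm.toLinearMap ∘ₗ Bl), fun u w ↦ ?_⟩
  have h : flat (e.symm (Bl u)) = Bl u := e.apply_symm_apply (Bl u)
  simpa [flat, Bl] using congrArg (fun l ↦ l w) h

lemma exists_koszul_hom (hY : MDiffAt (T% Y) x) :
    ∃ A : TangentSpace I x →L[ℝ] TangentSpace I x,
      ∀ X Z : Π x : M, TangentSpace I x, MDiffAt (T% X) x → MDiffAt (T% Z) x →
        g.inner x (A (X x)) (Z x) = koszul g Y X Z x := by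
  obtain ⟨A, hA⟩ := exists_inner_eq g x (TensorialAt.mkHom₂ (fun X Z ↦ koszul g Y X Z x) x
    (fun Z hZ ↦ koszul_tensorial_dir g hY hZ) (fun X hX ↦ koszul_tensorial_test g hY hX))
  refine ⟨A, fun X Z hX hZ ↦ ?_⟩
  rw [hA]
  exact TensorialAt.mkHom₂_apply _ _ hX hZ

/-- Existence of the Levi-Civita connection. -/
theorem exists_isLeviCivita :
    ∃ cov : CovariantDerivative I E (TangentSpace I : M → Type _), IsLeviCivita g cov := by
  classical
  let D : (Π x : M, TangentSpace I x) → (Π x : M, TangentSpace I x →L[ℝ] TangentSpace I x) :=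
    fun Y x ↦ if hY : MDiffAt (T% Y) x then (exists_koszul_hom g hY).choose else 0
  have hD : ∀ (X Y Z : Π x : M, TangentSpace I x) (x : M), MDiffAt (T% X) x → MDiffAt (T% Y) x →
      MDiffAt (T% Z) x → g.inner x (D Y x (X x)) (Z x) = koszul g Y X Z x := by
    intro X Y Z x hX hY hZ
    simp only [D, dif_pos hY]
    exact (exists_koszul_hom g hY).choose_spec X Z hX hZ
  refine ⟨⟨D, ⟨?_, ?_⟩⟩, ⟨?_, ?_⟩⟩
  · intro Y Y' x hY hY' _
    refine eq_of_forall_field g fun X Z hX hZ ↦ ?_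
    rw [hD _ _ _ _ hX (mdifferentiableAt_add_section hY hY') hZ,
      koszul_add_field g hY hY' hX hZ]
    simp [hD _ _ _ _ hX hY hZ, hD _ _ _ _ hX hY' hZ]
  · intro Y f x hY hf _
    refine eq_of_forall_field g fun X Z hX hZ ↦ ?_
    rw [hD _ _ _ _ hX (hf.smul_section hY) hZ, koszul_smul_field g hf hY hX hZ]
    simp [hD _ _ _ _ hX hY hZ]
  · intro X Y x hX hY
    refine ext_inner g fun w ↦ ?_
    have hZ := FiberBundle.mdifferentiableAt_extend I E w
    have h1 := hD X Y _ x hX hY hZ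
    have h2 := hD Y X _ x hY hX hZ
    simp only [FiberBundle.extend_apply_self] at h1 h2
    simp only [map_sub, sub_apply, h1, h2, koszul]
    rw [metricPair_comm g (X := Y) (Y := X), mlieBracket_swap_apply (V := Y) (W := X)]
    simp
    ring
  · intro X Y Z x hX hY hZ
    have h1 := hD X Y Z x hX hY hZ
    have h2 := hD X Z Y x hX hZ hY
    rw [h1, g.symm x (Y x), h2, koszul, koszul, metricPair_comm g (X := Z) (Y := Y),
      mlieBracket_swap_apply (V := Z) (W := Y)]
    simp
    ring

/-- The Levi-Civita connection of `g`. -/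
def leviCivita : CovariantDerivative I E (TangentSpace I : M → Type _) :=
  (exists_isLeviCivita g).choose

theorem isLeviCivita_leviCivita : IsLeviCivita g (leviCivita g) :=
  (exists_isLeviCivita g).choose_spec

end LeviCivita

section Operators

variable {E : Type*} [NormedAddCommGroup E] [NormedSpace ℝ E]
  {H : Type*} [TopologicalSpace H] {I : ModelWithCorners ℝ E H}
  {M : Type*} [TopologicalSpace M] [ChartedSpace H M] [IsManifold I ∞ M]

/-- The vector field `X` is smooth at `x`. -/
def SmoothFieldAt (I : ModelWithCorners ℝ E H) [IsManifold I ∞ M]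
    (X : Π x : M, TangentSpace I x) (x : M) : Prop :=
  ContMDiffAt I I.tangent ∞ (fun y ↦ (⟨y, X y⟩ : TangentBundle I M)) x

/-- The curvature `R(X, Y)Z = ∇_X ∇_Y Z - ∇_Y ∇_X Z - ∇_{[X, Y]} Z`. -/
def curvature (cov : CovariantDerivative I E (TangentSpace I : M → Type _))
    (X Y Z : Π x : M, TangentSpace I x) (x : M) : TangentSpace I x :=
  cov (fun y ↦ cov Z y (Y y)) x (X x) - cov (fun y ↦ cov Z y (X y)) x (Y x)
    - cov Z x (mlieBracket I X Y x)

/-- The exterior derivative of a one-form evaluated on two vector fields, normalized by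
`dη(X, Y) = X(η(Y)) - Y(η(X)) - η([X, Y])`. -/
def extDerivOneForm (η : Π x : M, TangentSpace I x →L[ℝ] ℝ)
    (X Y : Π x : M, TangentSpace I x) (x : M) : ℝ :=
  mvfderiv I (fun y ↦ η y (Y y)) x (X x) - mvfderiv I (fun y ↦ η y (X y)) x (Y x)
    - η x (mlieBracket I X Y x)

/-- The Lie derivative `(L_ξ T) X = [ξ, T X] - T [ξ, X]` of an operator `T` on vector fields. -/
def lieDerivEnd (ξ : Π x : M, TangentSpace I x)
    (T : (Π x : M, TangentSpace I x) → (Π x : M, TangentSpace I x))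
    (X : Π x : M, TangentSpace I x) (x : M) : TangentSpace I x :=
  mlieBracket I ξ (T X) x - T (mlieBracket I ξ X) x

/-- The value of `η ∧ (dη)^n` on `2n + 1` vector fields, up to a positive constant factor that
depends on `n` only. -/
def wedgeContact (n : ℕ) (η : Π x : M, TangentSpace I x →L[ℝ] ℝ)
    (V : Fin (2 * n + 1) → Π x : M, TangentSpace I x) (x : M) : ℝ :=
  ∑ σ : Equiv.Perm (Fin (2 * n + 1)), ((Equiv.Perm.sign σ : ℤ) : ℝ) *
    (η x (V (σ 0) x) * ∏ i : Fin n, extDerivOneForm η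
      (V (σ ⟨2 * i.val + 1, by omega⟩)) (V (σ ⟨2 * i.val + 2, by omega⟩)) x)

end Operators

/-- A contact metric structure `(η, ξ, φ, g)` on a manifold `M` of dimension `2n + 1`.
Identities between tensors are tested at `x` on vector fields that are smooth at `x`. -/
structure ContactMetricStructure (n : ℕ) (M : Type*) [TopologicalSpace M]
    [ChartedSpace (EuclideanSpace ℝ (Fin (2 * n + 1))) M]
    [IsManifold (𝓡 (2 * n + 1)) ∞ M] where
  /-- the contact form -/
  η : Π x : M, TangentSpace (𝓡 (2 * n + 1)) x →L[ℝ] ℝ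
  /-- the Reeb field -/
  ξ : Π x : M, TangentSpace (𝓡 (2 * n + 1)) x
  /-- the structure endomorphism -/
  φ : Π x : M, TangentSpace (𝓡 (2 * n + 1)) x →L[ℝ] TangentSpace (𝓡 (2 * n + 1)) x
  /-- the Riemannian metric -/
  g : ContMDiffRiemannianMetric (𝓡 (2 * n + 1)) ∞ (EuclideanSpace ℝ (Fin (2 * n + 1)))
    (TangentSpace (𝓡 (2 * n + 1)) : M → Type _)
  smooth_η : ContMDiff (𝓡 (2 * n + 1))
    ((𝓡 (2 * n + 1)).prod 𝓘(ℝ, EuclideanSpace ℝ (Fin (2 * n + 1)) →L[ℝ] ℝ)) ∞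
    (fun x ↦ TotalSpace.mk' (EuclideanSpace ℝ (Fin (2 * n + 1)) →L[ℝ] ℝ) x (η x))
  smooth_ξ : ∀ x, SmoothFieldAt (𝓡 (2 * n + 1)) ξ x
  smooth_φ : ContMDiff (𝓡 (2 * n + 1))
    ((𝓡 (2 * n + 1)).prod 𝓘(ℝ, EuclideanSpace ℝ (Fin (2 * n + 1)) →L[ℝ]
      EuclideanSpace ℝ (Fin (2 * n + 1)))) ∞
    (fun x ↦ TotalSpace.mk' (EuclideanSpace ℝ (Fin (2 * n + 1)) →L[ℝ]
      EuclideanSpace ℝ (Fin (2 * n + 1))) x (φ x))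
  /-- `η ∧ (dη)^n` vanishes nowhere. -/
  contact : ∀ x : M, ∃ V : Fin (2 * n + 1) → Π y : M, TangentSpace (𝓡 (2 * n + 1)) y,
    (∀ i, SmoothFieldAt (𝓡 (2 * n + 1)) (V i) x) ∧ wedgeContact n η V x ≠ 0
  η_ξ : ∀ x, η x (ξ x) = 1
  unit_ξ : ∀ x, g.inner x (ξ x) (ξ x) = 1
  φ_φ : ∀ x (v : TangentSpace (𝓡 (2 * n + 1)) x), φ x (φ x v) = -v + η x v • ξ x
  φ_ξ : ∀ x, φ x (ξ x) = 0
  /-- `dη(X, Y) = 2 g(X, φ Y)`. -/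
  dη_eq : ∀ (X Y : Π y : M, TangentSpace (𝓡 (2 * n + 1)) y) (x : M),
    SmoothFieldAt (𝓡 (2 * n + 1)) X x → SmoothFieldAt (𝓡 (2 * n + 1)) Y x →
      extDerivOneForm η X Y x = 2 * g.inner x (X x) (φ x (Y x))

namespace ContactMetricStructure

variable {n : ℕ} {M : Type*} [TopologicalSpace M]
  [ChartedSpace (EuclideanSpace ℝ (Fin (2 * n + 1))) M] [IsManifold (𝓡 (2 * n + 1)) ∞ M]
  (S : ContactMetricStructure n M)

/-- The tensor `h = (1/2) L_ξ φ`, as an operator on vector fields. -/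
def h (X : Π x : M, TangentSpace (𝓡 (2 * n + 1)) x) (x : M) : TangentSpace (𝓡 (2 * n + 1)) x :=
  (1 / 2 : ℝ) • lieDerivEnd S.ξ (fun Y y ↦ S.φ y (Y y)) X x

/-- The structure is K-contact if `h` vanishes identically. -/
def IsKContact : Prop :=
  ∀ (X : Π x : M, TangentSpace (𝓡 (2 * n + 1)) x) (x : M), SmoothFieldAt (𝓡 (2 * n + 1)) X x → S.h X x = 0

/-- The weak `(κ, μ)` condition `R(X, ξ)ξ = κ (X - η(X) ξ) + μ h X`, with `R` the curvature of the
Levi-Civita connection of `g`. -/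
def IsWeaklyKappaMu (κ μ : ℝ) : Prop :=
  ∀ (X : Π x : M, TangentSpace (𝓡 (2 * n + 1)) x) (x : M), SmoothFieldAt (𝓡 (2 * n + 1)) X x →
    curvature (leviCivita S.g) X S.ξ S.ξ x
      = κ • (X x - S.η x (X x) • S.ξ x) + μ • S.h X x

end ContactMetricStructure

/-- The Boeckx invariant `(1 - μ/2) / √(1 - κ)` (meaningful for `κ < 1`, which holds on every
weakly `(κ, μ)`-space that is not K-contact). -/
def boeckxInvariant (κ μ : ℝ) : ℝ := (1 - μ / 2) / √(1 - κ)

end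

/-!
For any contact metric structure the Jacobi operator of the Reeb field is an expression in Lie
derivatives along `ξ`. Indeed `∇ξ = -φ - φ h` (`cov_ξ`): the skew part comes from
`dη = 2 g(·, φ ·)`, the symmetric part from `L_ξ dη = 0` and `L_ξ φ = 2 h`. Since `∇_ξ ξ = 0` and
`∇` is torsion-free, `R(·, ξ)ξ = -L_ξ(∇ξ) - (∇ξ)²`. With `P = Id - η ⊗ ξ` this expands to
`R(·, ξ)ξ = P + 2 h + h² + φ (L_ξ h)` (`curvature_ξ_ξ`).

For a weakly `(κ, μ)`-structure this determines `φ (L_ξ h)` in terms of `P`, `h` and `h²`.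
Comparing with the Lie derivative of `h φ + φ h = 0` gives `h² = (1 - κ) P`
(`IsWeaklyKappaMu.hEnd_hEnd`) and then `L_ξ h = (2 - μ) φ h + 2 (1 - κ) φ`
(`IsWeaklyKappaMu.lieh_eq`).

So the prescribed `φ₁` has the form `p φ h + q φ` with constants `p`, `q`, and for `h² = s² P`
such an endomorphism satisfies `φ₁² = -P` exactly when `q² - s² p² = 1`. The metric forced by
`dη = 2 g₁(·, φ₁ ·)` is `g₁ = g((p h + q P) ·, ·) + η ⊗ η`; it is positive because `h` has eigenvalues
`±s` on the contact hyperplanes and `|p| s < q` (`exists_deformInner_ge`). Finally `h₁ = ½ L_ξ φ₁`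
is a constant multiple of `h`, so `L_ξ h₁` is a constant multiple of `φ₁`, and the formula for the
Jacobi operator applied to the deformed structure gives the weak `(κ₁, 2)` condition.

Endomorphism fields are handled as tensors throughout. `IsLieDeriv` records that one is the Lie
derivative of another, and smoothness is tested on vector fields (`contMDiff_hom_of_apply`).
-/

noncomputable section

/-! ### Vector fields smooth at a point -/

section SmoothFields

variable {E : Type*} [NormedAddCommGroup E] [NormedSpace ℝ E]
  {H : Type*} [TopologicalSpace H] {I : ModelWithCorners ℝ E H}
  {M : Type*} [TopologicalSpace M] [ChartedSpace H M] [IsManifold I ∞ M]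
  {X Y Z ξ : Π x : M, TangentSpace I x} {x : M} {f : M → ℝ}

lemma SmoothFieldAt.mdiffAt (hX : SmoothFieldAt I X x) : MDiffAt (T% X) x :=
  ContMDiffAt.mdifferentiableAt (n := ∞) hX (by simp)

lemma SmoothFieldAt.eventually_mdiffAt (hX : SmoothFieldAt I X x) :
    ∀ᶠ y in nhds x, MDiffAt (T% X) y := by
  have h1 : ContMDiffAt I I.tangent 1 (fun y ↦ (⟨y, X y⟩ : TangentBundle I M)) x :=
    ContMDiffAt.of_le hX (by exact_mod_cast le_top)
  filter_upwards [(contMDiffAt_iff_contMDiffAt_nhds (by simp)).mp h1] with y hy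
  exact hy.mdifferentiableAt one_ne_zero

lemma smoothFieldAt_extend (v : TangentSpace I x) :
    SmoothFieldAt I (FiberBundle.extend E v) x :=
  FiberBundle.contMDiffAt_extend I E v

lemma eventually_smoothFieldAt_extend (v : TangentSpace I x) :
    ∀ᶠ y in nhds x, SmoothFieldAt I (FiberBundle.extend E v) y := by
  obtain ⟨s, hs, h⟩ := FiberBundle.exists_contMDiffOn_extend (k := ∞) I E v
  filter_upwards [eventually_mem_nhds_iff.mpr hs] with y hy
  exact h.contMDiffAt hy

/-- A function smooth at `x` has smooth derivative along a field smooth at `x`. -/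
lemma contMDiffAt_mvfderiv_apply (hf : CMDiffAt ∞ f x) (hX : SmoothFieldAt I X x) :
    CMDiffAt ∞ (fun y ↦ mvfderiv I f y (X y)) x := by
  have h1 := ContMDiffAt.mfderiv_const (I' := 𝓘(ℝ, ℝ)) (m := ∞) (n := ∞) hf (by simp)
  have h2 := ContMDiffAt.clm_apply_of_inCoordinates (b₂ := f) h1 hX hf
  rw [contMDiffAt_totalSpace] at h2
  simpa using! h2.2

variable [CompleteSpace E]

lemma SmoothFieldAt.mlieBracket (hX : SmoothFieldAt I X x) (hY : SmoothFieldAt I Y x) :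
    SmoothFieldAt I (mlieBracket I X Y) x := by
  have : IsManifold I (minSmoothness ℝ 2) M := by
    rw [minSmoothness_of_isRCLikeNormedField]; infer_instance
  have : IsManifold I ((⊤ : ℕ∞) + 1) M := inferInstanceAs (IsManifold I ∞ M)
  exact ContMDiffAt.mlieBracket_vectorField (m := ⊤) (n := ⊤) hX hY (by simp)

lemma leibniz_mlieBracket_of_smooth (hX : SmoothFieldAt I X x) (hY : SmoothFieldAt I Y x)
    (hZ : SmoothFieldAt I Z x) :
    mlieBracket I X (mlieBracket I Y Z) x =
      mlieBracket I (mlieBracket I X Y) Z x + mlieBracket I Y (mlieBracket I X Z) x := by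
  have h2 : minSmoothness ℝ 2 ≤ (∞ : WithTop ℕ∞) := by
    rw [minSmoothness_of_isRCLikeNormedField]; exact WithTop.coe_le_coe.mpr le_top
  have : IsManifold I (minSmoothness ℝ 3) M := by
    simp only [minSmoothness_of_isRCLikeNormedField]; infer_instance
  exact leibniz_identity_mlieBracket_apply (ContMDiffAt.of_le hX h2) (ContMDiffAt.of_le hY h2)
    (ContMDiffAt.of_le hZ h2)

end SmoothFields

/-! ### Smooth sections of bundles of linear maps -/

section HomSections

variable {E : Type*} [NormedAddCommGroup E] [NormedSpace ℝ E] [FiniteDimensional ℝ E]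
  {H : Type*} [TopologicalSpace H] {I : ModelWithCorners ℝ E H}
  {M : Type*} [TopologicalSpace M] [ChartedSpace H M]

/-- A map into a space of linear maps with finite-dimensional source is smooth if its evaluations
at all vectors are. -/
lemma contMDiffAt_clm_of_apply {F : Type*} [NormedAddCommGroup F] [NormedSpace ℝ F]
    {A : M → E →L[ℝ] F} {x : M} (h : ∀ v, CMDiffAt ∞ (fun y ↦ A y v) x) :
    CMDiffAt ∞ A x := by
  let b := Module.finBasis ℝ E
  have hA : A = fun y ↦ ∑ i, ContinuousLinearMap.smulRightL ℝ E F
      (b.coord i).toContinuousLinearMap (A y (b i)) := by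
    ext y v
    have hv := congrArg (A y) (b.sum_repr v)
    rw [map_sum] at hv
    simpa using hv.symm
  rw [hA]
  refine ContMDiffAt.sum fun i _ ↦ ?_
  exact (ContinuousLinearMap.contMDiff _).contMDiffAt.comp x (h (b i))

variable [IsManifold I ∞ M]
  {F : Type*} [NormedAddCommGroup F] [NormedSpace ℝ F] {V : M → Type*}
  [TopologicalSpace (TotalSpace F V)] [∀ x, AddCommGroup (V x)] [∀ x, Module ℝ (V x)]
  [∀ x, TopologicalSpace (V x)] [∀ x, IsTopologicalAddGroup (V x)]
  [∀ x, ContinuousSMul ℝ (V x)] [FiberBundle F V] [VectorBundle ℝ F V]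

/-- A field of linear maps on tangent spaces is smooth as soon as it sends vector fields smooth at
a point to sections smooth at that point. -/
lemma contMDiff_hom_of_apply {A : Π x : M, TangentSpace I x →L[ℝ] V x}
    (h : ∀ (X : Π x : M, TangentSpace I x) (x : M), SmoothFieldAt I X x →
      CMDiffAt ∞ (fun y ↦ TotalSpace.mk' F y (A y (X y))) x) :
    ContMDiff I (I.prod 𝓘(ℝ, E →L[ℝ] F)) ∞
      (fun x ↦ TotalSpace.mk' (E →L[ℝ] F) x (A x)) := by
  intro x
  rw [contMDiffAt_hom_bundle]
  refine ⟨contMDiffAt_id, contMDiffAt_clm_of_apply fun v ↦ ?_⟩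
  let e := trivializationAt E (TangentSpace I : M → Type _) x
  have hx : x ∈ e.baseSet := FiberBundle.mem_baseSet_trivializationAt' x
  have hX : SmoothFieldAt I (fun y ↦ e.symmL ℝ y v) x :=
    ContMDiffAt.clm_bundle_apply (E₁ := Bundle.Trivial M E) (e.contMDiffAt_symmL hx)
      (contMDiffAt_totalSpace.mpr ⟨contMDiffAt_id, contMDiffAt_const⟩)
  -- in coordinates, evaluating `A` at `v` is applying `A` to the local frame field with constant
  -- coordinates `v`
  have h2 := (contMDiffAt_totalSpace.mp (h _ x hX)).2
  refine h2.congr_of_eventuallyEq ?_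
  have hx' : x ∈ (trivializationAt F V x).baseSet := FiberBundle.mem_baseSet_trivializationAt' x
  filter_upwards [e.open_baseSet.mem_nhds hx,
    (trivializationAt F V x).open_baseSet.mem_nhds hx'] with y hy hy'
  simp [ContinuousLinearMap.inCoordinates, e, hy']

end HomSections

/-! ### Lie derivatives of fields of endomorphisms -/

section LieDerivative

variable {E : Type*} [NormedAddCommGroup E] [NormedSpace ℝ E]
  {H : Type*} [TopologicalSpace H] {I : ModelWithCorners ℝ E H}
  {M : Type*} [TopologicalSpace M] [ChartedSpace H M]
  {X Y ξ : Π x : M, TangentSpace I x} {x : M}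

lemma lieDerivEnd_congr_left {F G : (Π x : M, TangentSpace I x) → (Π x : M, TangentSpace I x)}
    (h : F X =ᶠ[nhds x] G X) (h' : F (mlieBracket I ξ X) x = G (mlieBracket I ξ X) x) :
    lieDerivEnd ξ F X x = lieDerivEnd ξ G X x := by
  rw [lieDerivEnd, lieDerivEnd, h', Filter.EventuallyEq.rfl.mlieBracket_vectorField_eq h]

variable [IsManifold I ∞ M]
  {T T' S S' : Π x : M, TangentSpace I x →L[ℝ] TangentSpace I x}

/-- The field of endomorphisms `T` of the tangent spaces is smooth. -/
def SmoothEnd (T : Π x : M, TangentSpace I x →L[ℝ] TangentSpace I x) : Prop :=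
  ContMDiff I (I.prod 𝓘(ℝ, E →L[ℝ] E)) ∞ (fun x ↦ TotalSpace.mk' (E →L[ℝ] E) x (T x))

lemma SmoothEnd.smoothFieldAt (hT : SmoothEnd T) (hX : SmoothFieldAt I X x) :
    SmoothFieldAt I (fun y ↦ T y (X y)) x :=
  ContMDiffAt.clm_bundle_apply (F₁ := E) (F₂ := E) (hT x) hX

lemma SmoothEnd.mdiffAt (hT : SmoothEnd T) (hX : MDiffAt (T% X) x) :
    MDiffAt (T% (fun y ↦ T y (X y))) x :=
  MDifferentiableAt.clm_bundle_apply (F₁ := E) (F₂ := E) ((hT x).mdifferentiableAt (by simp)) hX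

/-- Linear maps on a tangent space agree if they agree on the values of fields that are smooth in a
neighbourhood of the point, not merely at the point. -/
lemma clm_eq_of_smooth {W : Type*} [AddCommGroup W] [Module ℝ W] [TopologicalSpace W]
    {A B : TangentSpace I x →L[ℝ] W}
    (h : ∀ X : Π x : M, TangentSpace I x, (∀ᶠ y in nhds x, SmoothFieldAt I X y) →
      A (X x) = B (X x)) : A = B := by
  ext v
  simpa using h (FiberBundle.extend E v) (eventually_smoothFieldAt_extend v)

/-- `T'` is the Lie derivative of the field of endomorphisms `T` along `ξ`, as a field of
endomorphisms: `[ξ, T X] - T [ξ, X] = T' X` at every point at which `X` is differentiable. -/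
def IsLieDeriv (ξ : Π x : M, TangentSpace I x)
    (T T' : Π x : M, TangentSpace I x →L[ℝ] TangentSpace I x) : Prop :=
  ∀ ⦃X : Π x : M, TangentSpace I x⦄ ⦃x : M⦄, MDiffAt (T% X) x →
    lieDerivEnd ξ (fun Y y ↦ T y (Y y)) X x = T' x (X x)

lemma IsLieDeriv.unique (h : IsLieDeriv ξ T S) (h' : IsLieDeriv ξ T S') : S = S' := by
  ext1 x
  refine clm_eq_of_smooth fun X hX ↦ ?_
  rw [← h hX.self_of_nhds.mdiffAt, ← h' hX.self_of_nhds.mdiffAt]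

variable [FiniteDimensional ℝ E]

lemma smoothEnd_of_apply
    (h : ∀ (X : Π x : M, TangentSpace I x) (x : M), SmoothFieldAt I X x →
      SmoothFieldAt I (fun y ↦ T y (X y)) x) : SmoothEnd T :=
  contMDiff_hom_of_apply h

lemma SmoothEnd.comp (hS : SmoothEnd S) (hT : SmoothEnd T) : SmoothEnd fun x ↦ S x ∘L T x :=
  smoothEnd_of_apply fun _ _ hX ↦ hS.smoothFieldAt (hT.smoothFieldAt hX)

lemma SmoothEnd.add (hS : SmoothEnd S) (hT : SmoothEnd T) : SmoothEnd fun x ↦ S x + T x :=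
  smoothEnd_of_apply fun _ _ hX ↦
    ContMDiffAt.add_section (hS.smoothFieldAt hX) (hT.smoothFieldAt hX)

lemma SmoothEnd.smul (c : ℝ) (hT : SmoothEnd T) : SmoothEnd fun x ↦ c • T x :=
  smoothEnd_of_apply fun _ _ hX ↦ ContMDiffAt.const_smul_section (hT.smoothFieldAt hX)

lemma tensorialAt_lieDerivEnd (ξ : Π x : M, TangentSpace I x) (hT : SmoothEnd T) (x : M) :
    TensorialAt I E (fun X ↦ lieDerivEnd ξ (fun Y y ↦ T y (Y y)) X x) x where
  smul {f X} hf hX := by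
    have h1 : (fun y ↦ T y ((f • X) y)) = f • fun y ↦ T y (X y) := by ext y; simp
    simp only [lieDerivEnd, h1, mlieBracket_smul_right hf hX,
      mlieBracket_smul_right hf (hT.mdiffAt hX)]
    simp [smul_sub]
  add {X Y} hX hY := by
    have h1 : (fun y ↦ T y ((X + Y) y)) = (fun y ↦ T y (X y)) + fun y ↦ T y (Y y) := by
      ext y; simp
    simp only [lieDerivEnd, h1, mlieBracket_add_right hX hY,
      mlieBracket_add_right (hT.mdiffAt hX) (hT.mdiffAt hY), map_add]
    abel

/-- The Lie derivative of a smooth field of endomorphisms exists and is smooth. -/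
lemma exists_isLieDeriv (hξ : ∀ x, SmoothFieldAt I ξ x) (hT : SmoothEnd T) :
    ∃ T', SmoothEnd T' ∧ IsLieDeriv ξ T T' := by
  have h : IsLieDeriv ξ T fun x ↦ TensorialAt.mkHom _ x (tensorialAt_lieDerivEnd ξ hT x) :=
    fun X x hX ↦ (TensorialAt.mkHom_apply (tensorialAt_lieDerivEnd ξ hT x) hX).symm
  refine ⟨_, smoothEnd_of_apply fun X x hX ↦ ?_, h⟩
  have h1 : SmoothFieldAt I (lieDerivEnd ξ (fun Y y ↦ T y (Y y)) X) x :=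
    ContMDiffAt.sub_section ((hξ x).mlieBracket (hT.smoothFieldAt hX))
      (hT.smoothFieldAt ((hξ x).mlieBracket hX))
  refine ContMDiffAt.congr_of_eventuallyEq h1 ?_
  filter_upwards [hX.eventually_mdiffAt] with y hy
  rw [← h hy]

namespace IsLieDeriv

/-- It suffices to compute a Lie derivative on fields that are smooth near a point, since both sides
are tensorial. -/
lemma of_smooth (hξ : ∀ x, SmoothFieldAt I ξ x) (hT : SmoothEnd T)
    (h : ∀ (X : Π x : M, TangentSpace I x) (x : M), (∀ᶠ y in nhds x, SmoothFieldAt I X y) →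
      lieDerivEnd ξ (fun Y y ↦ T y (Y y)) X x = T' x (X x)) : IsLieDeriv ξ T T' := by
  obtain ⟨S, -, hS⟩ := exists_isLieDeriv hξ hT
  have hST : S = T' := by
    ext1 x
    refine clm_eq_of_smooth fun X hX ↦ ?_
    rw [← hS hX.self_of_nhds.mdiffAt, h X x hX]
  exact hST ▸ hS

lemma comp (hξ : ∀ x, SmoothFieldAt I ξ x) (hS : SmoothEnd S) (hT : SmoothEnd T)
    (h : IsLieDeriv ξ S S') (h' : IsLieDeriv ξ T T') :
    IsLieDeriv ξ (fun x ↦ S x ∘L T x) fun x ↦ S' x ∘L T x + S x ∘L T' x := by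
  refine of_smooth hξ (hS.comp hT) fun X x hX ↦ ?_
  have h1 := h (hT.mdiffAt hX.self_of_nhds.mdiffAt)
  have h2 := h' hX.self_of_nhds.mdiffAt
  simp only [lieDerivEnd, ContinuousLinearMap.comp_apply, add_apply] at h1 h2 ⊢
  rw [← h1, ← h2]
  simp

lemma add (hS : SmoothEnd S) (hT : SmoothEnd T)
    (h : IsLieDeriv ξ S S') (h' : IsLieDeriv ξ T T') :
    IsLieDeriv ξ (fun x ↦ S x + T x) fun x ↦ S' x + T' x := by
  intro X x hX
  have h1 : (fun y ↦ (S y + T y) (X y)) = (fun y ↦ S y (X y)) + fun y ↦ T y (X y) := by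
    ext y; simp
  have h2 := h hX
  have h3 := h' hX
  simp only [lieDerivEnd, add_apply] at h2 h3 ⊢
  rw [← h2, ← h3, show (fun y ↦ S y (X y) + T y (X y)) = (fun y ↦ S y (X y)) + fun y ↦ T y (X y)
    from rfl, mlieBracket_add_right (hS.mdiffAt hX) (hT.mdiffAt hX)]
  abel

lemma smul (c : ℝ) (hT : SmoothEnd T) (h : IsLieDeriv ξ T T') :
    IsLieDeriv ξ (fun x ↦ c • T x) fun x ↦ c • T' x := by
  intro X x hX
  have h2 := h hX
  simp only [lieDerivEnd, smul_apply] at h2 ⊢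
  rw [← h2, show (fun y ↦ c • T y (X y)) = c • fun y ↦ T y (X y) from rfl,
    mlieBracket_const_smul_right (hT.mdiffAt hX)]
  simp [smul_sub]

end IsLieDeriv

end LieDerivative

/-! ### The Lie bracket as a commutator of derivations -/

section Commutator

variable {E : Type*} [NormedAddCommGroup E] [NormedSpace ℝ E] [FiniteDimensional ℝ E]
  {H : Type*} [TopologicalSpace H] {I : ModelWithCorners ℝ E H}
  {M : Type*} [TopologicalSpace M] [ChartedSpace H M] [IsManifold I ∞ M]
  {X Y : Π x : M, TangentSpace I x} {x : M} {f : M → ℝ}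

/-- The Lie bracket acts on functions as the commutator of derivations. This is the Jacobi identity
for `X`, `Y` and `f • Z`, where `Z x ≠ 0`. -/
lemma mvfderiv_mlieBracket (hf : CMDiffAt ∞ f x) (hX : SmoothFieldAt I X x)
    (hY : SmoothFieldAt I Y x) :
    mvfderiv I f x (mlieBracket I X Y x) =
      mvfderiv I (fun y ↦ mvfderiv I f y (Y y)) x (X x)
        - mvfderiv I (fun y ↦ mvfderiv I f y (X y)) x (Y x) := by
  rcases subsingleton_or_nontrivial (TangentSpace I x) with h | h
  · rw [Subsingleton.elim (mlieBracket I X Y x) 0, Subsingleton.elim (X x) 0,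
      Subsingleton.elim (Y x) 0]
    simp
  obtain ⟨v, hv⟩ := exists_ne (0 : TangentSpace I x)
  set Z := FiberBundle.extend E v with hZdef
  have hZ : SmoothFieldAt I Z x := smoothFieldAt_extend v
  have hZx : Z x = v := by simp [hZdef]
  have hf1 : ∀ᶠ y in nhds x, MDiffAt f y := by
    filter_upwards [(contMDiffAt_iff_contMDiffAt_nhds (n := 1) (by simp)).mp
      (hf.of_le (by exact_mod_cast le_top))] with y hy
    exact hy.mdifferentiableAt one_ne_zero
  have hfx := hf1.self_of_nhds
  have hXf := contMDiffAt_mvfderiv_apply hf hX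
  have hYf := contMDiffAt_mvfderiv_apply hf hY
  have key : ∀ {W : Π x : M, TangentSpace I x},
      mlieBracket I W (f • Z) =ᶠ[nhds x]
        ((fun y ↦ mvfderiv I f y (W y)) • Z + f • mlieBracket I W Z) := by
    intro W
    filter_upwards [hf1, hZ.eventually_mdiffAt] with y h1 h2
    rw [mlieBracket_smul_right h1 h2]
    rfl
  -- the terms of `J` without second derivatives of `f` cancel by the Jacobi identity `J0`
  have J := leibniz_mlieBracket_of_smooth hX hY (hf.smul_section hZ)
  have J0 := leibniz_mlieBracket_of_smooth hX hY hZ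
  rw [Filter.EventuallyEq.rfl.mlieBracket_vectorField_eq key,
    Filter.EventuallyEq.rfl.mlieBracket_vectorField_eq key,
    mlieBracket_smul_right hfx hZ.mdiffAt] at J
  have d1 := hXf.mdifferentiableAt (n := ∞) (by simp)
  have d2 := hYf.mdifferentiableAt (n := ∞) (by simp)
  have m1 := (hX.mlieBracket hZ).mdiffAt
  have m2 := (hY.mlieBracket hZ).mdiffAt
  rw [mlieBracket_add_right (d1.smul_section hZ.mdiffAt) (hfx.smul_section m1),
    mlieBracket_add_right (d2.smul_section hZ.mdiffAt) (hfx.smul_section m2),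
    mlieBracket_smul_right d1 hZ.mdiffAt, mlieBracket_smul_right d2 hZ.mdiffAt,
    mlieBracket_smul_right hfx m1, mlieBracket_smul_right hfx m2, J0, hZx] at J
  have hJ : (mvfderiv I f x (mlieBracket I X Y x) -
      (mvfderiv I (fun y ↦ mvfderiv I f y (Y y)) x (X x)
        - mvfderiv I (fun y ↦ mvfderiv I f y (X y)) x (Y x))) • v = 0 := by
    linear_combination (norm := module) (-1 : ℝ) • J
  exact sub_eq_zero.mp ((smul_eq_zero.mp hJ).resolve_right hv)

end Commutator

/-! ### The contact form, its exterior derivative and the Reeb field -/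

namespace ContactMetricStructure

variable {n : ℕ} {M : Type*} [TopologicalSpace M]
  [ChartedSpace (EuclideanSpace ℝ (Fin (2 * n + 1))) M] [IsManifold (𝓡 (2 * n + 1)) ∞ M]
  (S : ContactMetricStructure n M) {X Y : Π x : M, TangentSpace (𝓡 (2 * n + 1)) x} {x : M}

lemma smoothEnd_φ : SmoothEnd S.φ := S.smooth_φ

lemma contMDiffAt_η (hX : SmoothFieldAt (𝓡 (2 * n + 1)) X x) :
    ContMDiffAt (𝓡 (2 * n + 1)) 𝓘(ℝ) ∞ (fun y ↦ S.η y (X y)) x := by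
  have h : ContMDiffAt (𝓡 (2 * n + 1)) ((𝓡 (2 * n + 1)).prod 𝓘(ℝ)) ∞
      (fun m ↦ TotalSpace.mk' ℝ (E := Bundle.Trivial M ℝ) m (S.η m (X m))) x :=
    ContMDiffAt.clm_bundle_apply (F₁ := EuclideanSpace ℝ (Fin (2 * n + 1))) (S.smooth_η x) hX
  exact (contMDiffAt_totalSpace.mp h).2

lemma mdiffAt_η (hX : SmoothFieldAt (𝓡 (2 * n + 1)) X x) :
    MDifferentiableAt (𝓡 (2 * n + 1)) 𝓘(ℝ) (fun y ↦ S.η y (X y)) x :=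
  (S.contMDiffAt_η hX).mdifferentiableAt (by simp)

/-- `φ` is skew-adjoint, because `dη` is alternating. -/
lemma inner_φ_right (u v : TangentSpace (𝓡 (2 * n + 1)) x) :
    S.g.inner x u (S.φ x v) = - S.g.inner x (S.φ x u) v := by
  have h1 := S.dη_eq _ _ x (smoothFieldAt_extend u) (smoothFieldAt_extend v)
  have h2 := S.dη_eq _ _ x (smoothFieldAt_extend v) (smoothFieldAt_extend u)
  simp only [FiberBundle.extend_apply_self, extDerivOneForm] at h1 h2
  rw [mlieBracket_swap_apply, map_neg] at h2
  rw [S.g.symm x (S.φ x u)]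
  linarith

/-- The contact form is `g(ξ, ·)`: skew-adjointness of `φ`, applied to `φ ξ = 0`. -/
lemma inner_ξ (v : TangentSpace (𝓡 (2 * n + 1)) x) : S.g.inner x (S.ξ x) v = S.η x v := by
  have h := S.inner_φ_right (S.ξ x) (S.φ x v)
  rw [S.φ_φ, S.φ_ξ] at h
  simp only [map_add, map_neg, map_smul, map_zero, zero_apply, S.unit_ξ, smul_eq_mul] at h
  linarith

lemma η_φ (v : TangentSpace (𝓡 (2 * n + 1)) x) : S.η x (S.φ x v) = 0 := by
  rw [← S.inner_ξ, S.inner_φ_right, S.φ_ξ]; simp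

/-- The contact form is invariant under the Reeb field: `L_ξ η = 0`. -/
lemma mvfderiv_η_ξ (hX : SmoothFieldAt (𝓡 (2 * n + 1)) X x) :
    mvfderiv (𝓡 (2 * n + 1)) (fun y ↦ S.η y (X y)) x (S.ξ x)
      = S.η x (mlieBracket (𝓡 (2 * n + 1)) S.ξ X x) := by
  have h := S.dη_eq _ _ x (S.smooth_ξ x) hX
  have hc : (fun y ↦ S.η y (S.ξ y)) = fun _ ↦ (1 : ℝ) := funext S.η_ξ
  rw [S.inner_ξ, S.η_φ, extDerivOneForm, hc, mvfderiv_const] at h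
  simp only [zero_apply] at h
  linarith

/-- `dη` is invariant under the Reeb field: `L_ξ dη = 0`, written with `dη = 2 g(·, φ ·)`. -/
lemma mvfderiv_inner_φ_ξ (hX : ∀ᶠ y in nhds x, SmoothFieldAt (𝓡 (2 * n + 1)) X y)
    (hY : ∀ᶠ y in nhds x, SmoothFieldAt (𝓡 (2 * n + 1)) Y y) :
    mvfderiv (𝓡 (2 * n + 1)) (metricPair S.g X fun y ↦ S.φ y (Y y)) x (S.ξ x)
      = S.g.inner x (mlieBracket (𝓡 (2 * n + 1)) S.ξ X x) (S.φ x (Y x))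
        + S.g.inner x (X x) (S.φ x (mlieBracket (𝓡 (2 * n + 1)) S.ξ Y x)) := by
  have hXx := hX.self_of_nhds
  have hYx := hY.self_of_nhds
  have hξ := S.smooth_ξ x
  have e0 : (metricPair S.g X fun y ↦ S.φ y (Y y)) =ᶠ[nhds x]
      (fun _ ↦ (1 / 2 : ℝ)) *
      ((fun y ↦ mvfderiv (𝓡 (2 * n + 1)) (fun y ↦ S.η y (Y y)) y (X y))
      - (fun y ↦ mvfderiv (𝓡 (2 * n + 1)) (fun y ↦ S.η y (X y)) y (Y y))
      - fun y ↦ S.η y (mlieBracket (𝓡 (2 * n + 1)) X Y y)) := by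
    filter_upwards [hX, hY] with y h1 h2
    have := S.dη_eq X Y y h1 h2
    rw [extDerivOneForm] at this
    simp only [Pi.mul_apply, Pi.sub_apply, this, metricPair]
    ring
  have congr_d : ∀ {f k : M → ℝ}, f =ᶠ[nhds x] k →
      mvfderiv (𝓡 (2 * n + 1)) f x = mvfderiv (𝓡 (2 * n + 1)) k x := by
    intro f k h
    ext v
    simp only [mvfderiv, h.mfderiv_eq]
    rfl
  have d1 := (contMDiffAt_mvfderiv_apply (S.contMDiffAt_η hYx) hXx).mdifferentiableAt
    (n := ∞) (by simp)
  have d2 := (contMDiffAt_mvfderiv_apply (S.contMDiffAt_η hXx) hYx).mdifferentiableAt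
    (n := ∞) (by simp)
  have d3 := S.mdiffAt_η (hXx.mlieBracket hYx)
  -- `L_ξ η = 0` turns `η [ξ, X]` into `ξ (η X)`; the second derivatives of `η X` and `η Y` then
  -- cancel up to commutators, and the remaining brackets cancel by the Jacobi identity
  have e1 := S.dη_eq _ _ x (hξ.mlieBracket hXx) hYx
  have e2 := S.dη_eq _ _ x hXx (hξ.mlieBracket hYx)
  have c1 : (fun y ↦ S.η y (mlieBracket (𝓡 (2 * n + 1)) S.ξ X y)) =ᶠ[nhds x]
      fun y ↦ mvfderiv (𝓡 (2 * n + 1)) (fun y ↦ S.η y (X y)) y (S.ξ y) := by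
    filter_upwards [hX] with y h1 using (S.mvfderiv_η_ξ h1).symm
  have c2 : (fun y ↦ S.η y (mlieBracket (𝓡 (2 * n + 1)) S.ξ Y y)) =ᶠ[nhds x]
      fun y ↦ mvfderiv (𝓡 (2 * n + 1)) (fun y ↦ S.η y (Y y)) y (S.ξ y) := by
    filter_upwards [hY] with y h1 using (S.mvfderiv_η_ξ h1).symm
  rw [extDerivOneForm, congr_d c1, mvfderiv_mlieBracket (S.contMDiffAt_η hYx) hξ hXx] at e1
  rw [extDerivOneForm, congr_d c2, mvfderiv_mlieBracket (S.contMDiffAt_η hXx) hξ hYx] at e2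
  have J := congrArg (S.η x) (leibniz_mlieBracket_of_smooth hξ hXx hYx)
  rw [map_add] at J
  have e3 := S.mvfderiv_η_ξ (hXx.mlieBracket hYx)
  rw [congr_d e0, mvfderiv_mul mdifferentiableAt_const ((d1.sub d2).sub d3), mvfderiv_const,
    mvfderiv_sub (d1.sub d2) d3, mvfderiv_sub d1 d2]
  simp
  linarith

/-! ### The tensor `h` and its Lie derivative -/

/-- The tensor `h = (1/2) L_ξ φ` as a field of endomorphisms. -/
def hEnd (x : M) : TangentSpace (𝓡 (2 * n + 1)) x →L[ℝ] TangentSpace (𝓡 (2 * n + 1)) x :=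
  (1 / 2 : ℝ) • (exists_isLieDeriv S.smooth_ξ S.smoothEnd_φ).choose x

lemma smoothEnd_hEnd : SmoothEnd S.hEnd :=
  (exists_isLieDeriv S.smooth_ξ S.smoothEnd_φ).choose_spec.1.smul _

lemma isLieDeriv_φ : IsLieDeriv S.ξ S.φ fun x ↦ (2 : ℝ) • S.hEnd x := by
  intro X x hX
  rw [(exists_isLieDeriv S.smooth_ξ S.smoothEnd_φ).choose_spec.2 hX]
  simp [hEnd, smul_smul]

lemma h_eq_hEnd (hX : MDifferentiableAt (𝓡 (2 * n + 1)) (𝓡 (2 * n + 1)).tangent (T% X) x) :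
    S.h X x = S.hEnd x (X x) := by
  rw [h, S.isLieDeriv_φ hX]
  simp [smul_smul]

/-- The tensor `L_ξ h` as a field of endomorphisms. -/
def lieh : Π x : M, TangentSpace (𝓡 (2 * n + 1)) x →L[ℝ] TangentSpace (𝓡 (2 * n + 1)) x :=
  (exists_isLieDeriv S.smooth_ξ S.smoothEnd_hEnd).choose

lemma isLieDeriv_hEnd : IsLieDeriv S.ξ S.hEnd S.lieh :=
  (exists_isLieDeriv S.smooth_ξ S.smoothEnd_hEnd).choose_spec.2

/-- The operator `S.h` is tensorial only on differentiable fields, but this is enough: it is applied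
to fields that are differentiable near the point. -/
lemma lieDerivEnd_h_eq (hX : SmoothFieldAt (𝓡 (2 * n + 1)) X x) :
    lieDerivEnd S.ξ S.h X x = S.lieh x (X x) := by
  rw [← S.isLieDeriv_hEnd hX.mdiffAt]
  refine lieDerivEnd_congr_left ?_ (S.h_eq_hEnd ((S.smooth_ξ x).mlieBracket hX).mdiffAt)
  filter_upwards [hX.eventually_mdiffAt] with y hy using S.h_eq_hEnd hy

/-- The projection `v ↦ v - η(v) ξ` onto the contact hyperplanes. -/
def proj (x : M) : TangentSpace (𝓡 (2 * n + 1)) x →L[ℝ] TangentSpace (𝓡 (2 * n + 1)) x :=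
  ContinuousLinearMap.id ℝ _ - (S.η x).smulRight (S.ξ x)

lemma proj_apply (v : TangentSpace (𝓡 (2 * n + 1)) x) : S.proj x v = v - S.η x v • S.ξ x := rfl

lemma φ_comp_φ : (fun x ↦ S.φ x ∘L S.φ x) = fun x ↦ (-1 : ℝ) • S.proj x := by
  ext x v
  simp only [ContinuousLinearMap.comp_apply, S.φ_φ, smul_apply, proj_apply]
  module

lemma smoothEnd_proj : SmoothEnd S.proj := by
  have h := (S.smoothEnd_φ.comp S.smoothEnd_φ).smul (-1)
  convert! h using 2 with x
  rw [congrFun S.φ_comp_φ x]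
  simp

/-- `L_ξ (Id - η ⊗ ξ) = 0`, because `L_ξ η = 0` and `[ξ, ξ] = 0`. -/
lemma isLieDeriv_proj : IsLieDeriv S.ξ S.proj fun _ ↦ 0 := by
  refine IsLieDeriv.of_smooth S.smooth_ξ S.smoothEnd_proj fun X x hX ↦ ?_
  have hX := hX.self_of_nhds
  have e : (fun y ↦ S.proj y (X y)) = X + (-1 : ℝ) • ((fun y ↦ S.η y (X y)) • S.ξ) := by
    ext1 y; simp [proj_apply, sub_eq_add_neg]
  have hη := S.mdiffAt_η hX
  have hξ := (S.smooth_ξ x).mdiffAt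
  have hs : MDifferentiableAt (𝓡 (2 * n + 1)) (𝓡 (2 * n + 1)).tangent
      (T% ((-1 : ℝ) • ((fun y ↦ S.η y (X y)) • S.ξ))) x := (hη.smul_section hξ).smul_const_section
  rw [lieDerivEnd, e, mlieBracket_add_right hX.mdiffAt hs,
    mlieBracket_const_smul_right (hη.smul_section hξ), mlieBracket_smul_right hη hξ,
    S.mvfderiv_η_ξ hX, proj_apply]
  simp

/-- The endomorphisms `h` and `φ` anticommute, because `L_ξ (φ²) = -L_ξ P = 0`. -/
lemma hEnd_φ (v : TangentSpace (𝓡 (2 * n + 1)) x) :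
    S.hEnd x (S.φ x v) = - S.φ x (S.hEnd x v) := by
  have h1 := S.isLieDeriv_φ.comp S.smooth_ξ S.smoothEnd_φ S.smoothEnd_φ S.isLieDeriv_φ
  rw [φ_comp_φ] at h1
  have h2 := congrArg (fun T ↦ T x v) (h1.unique (S.isLieDeriv_proj.smul (-1) S.smoothEnd_proj))
  simp only [add_apply, ContinuousLinearMap.comp_apply, smul_apply, zero_apply, smul_zero,
    map_smul, ← smul_add] at h2
  exact eq_neg_of_add_eq_zero_left ((smul_eq_zero.mp h2).resolve_left two_ne_zero)

lemma hEnd_ξ : S.hEnd x (S.ξ x) = 0 := by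
  have h := S.isLieDeriv_φ (S.smooth_ξ x).mdiffAt
  have h0 : (fun y ↦ S.φ y (S.ξ y)) = 0 := funext fun y ↦ S.φ_ξ y
  rw [lieDerivEnd, h0, mlieBracket_self, mlieBracket_zero_right] at h
  simpa using h.symm

lemma η_hEnd (v : TangentSpace (𝓡 (2 * n + 1)) x) : S.η x (S.hEnd x v) = 0 := by
  have h : S.η x (S.hEnd x (S.φ x (S.φ x v))) = 0 := by rw [hEnd_φ, map_neg, η_φ, neg_zero]
  rw [φ_φ] at h
  simpa [hEnd_ξ] using h

/-! ### The covariant derivative of the Reeb field -/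

variable {cov : CovariantDerivative (𝓡 (2 * n + 1)) (EuclideanSpace ℝ (Fin (2 * n + 1)))
  (TangentSpace (𝓡 (2 * n + 1)) : M → Type _)}

/-- The invariance `L_ξ dη = 0` in terms of the Levi-Civita connection: brackets with `ξ` are
replaced by covariant derivatives, and `L_ξ φ` by `2 h`. -/
lemma inner_cov_ξ_φ (hc : IsLeviCivita S.g cov) (u w : TangentSpace (𝓡 (2 * n + 1)) x) :
    S.g.inner x (cov S.ξ x u) (S.φ x w) + 2 * S.g.inner x u (S.hEnd x w)
      + S.g.inner x u (cov S.ξ x (S.φ x w)) = 0 := by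
  obtain ⟨X, hX, rfl⟩ : ∃ X : Π x : M, TangentSpace (𝓡 (2 * n + 1)) x,
      (∀ᶠ y in nhds x, SmoothFieldAt (𝓡 (2 * n + 1)) X y) ∧ X x = u :=
    ⟨_, eventually_smoothFieldAt_extend u, by simp⟩
  obtain ⟨Y, hY, rfl⟩ : ∃ X : Π x : M, TangentSpace (𝓡 (2 * n + 1)) x,
      (∀ᶠ y in nhds x, SmoothFieldAt (𝓡 (2 * n + 1)) X y) ∧ X x = w :=
    ⟨_, eventually_smoothFieldAt_extend w, by simp⟩
  have hXx := hX.self_of_nhds.mdiffAt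
  have hYx := hY.self_of_nhds.mdiffAt
  have hφY := S.smoothEnd_φ.mdiffAt hYx
  have hξ := (S.smooth_ξ x).mdiffAt
  have e1 := S.mvfderiv_inner_φ_ξ hX hY
  have e2 := S.isLieDeriv_φ hYx
  rw [hc.metric hξ hXx hφY, eq_add_of_sub_eq (hc.torsion_free hξ hXx),
    eq_add_of_sub_eq (hc.torsion_free hξ hφY), eq_add_of_sub_eq e2] at e1
  simp only [map_add, add_apply, smul_apply, map_smul, smul_eq_mul] at e1
  linarith

/-- The skew part of `∇ξ` is `-φ`, since `η` is dual to `ξ` and `dη = 2 g(·, φ ·)`. -/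
lemma inner_cov_ξ_sub (hc : IsLeviCivita S.g cov) (u w : TangentSpace (𝓡 (2 * n + 1)) x) :
    S.g.inner x (cov S.ξ x u) w - S.g.inner x (cov S.ξ x w) u = 2 * S.g.inner x u (S.φ x w) := by
  have hX := smoothFieldAt_extend u
  have hY := smoothFieldAt_extend w
  have hξ := (S.smooth_ξ x).mdiffAt
  have e := S.dη_eq _ _ x hX hY
  have e1 : ∀ X : Π x : M, TangentSpace (𝓡 (2 * n + 1)) x,
      (fun y ↦ S.η y (X y)) = metricPair S.g S.ξ X := fun X ↦ funext fun y ↦ (S.inner_ξ _).symm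
  rw [extDerivOneForm, e1, e1, hc.metric hX.mdiffAt hξ hY.mdiffAt,
    hc.metric hY.mdiffAt hξ hX.mdiffAt, ← hc.torsion_free hX.mdiffAt hY.mdiffAt, map_sub,
    ← S.inner_ξ, ← S.inner_ξ] at e
  simp only [FiberBundle.extend_apply_self] at e
  linarith

lemma cov_ξ_ξ (hc : IsLeviCivita S.g cov) : cov S.ξ x (S.ξ x) = 0 := by
  refine ext_inner S.g fun w ↦ ?_
  have h1 := S.inner_cov_ξ_sub hc (S.ξ x) w
  have hW := smoothFieldAt_extend w
  have hξ := (S.smooth_ξ x).mdiffAt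
  have h2 := hc.metric hW.mdiffAt hξ hξ
  have h3 : metricPair S.g S.ξ S.ξ = fun _ ↦ 1 := funext S.unit_ξ
  rw [h3, mvfderiv_const, S.g.symm x (S.ξ x)] at h2
  rw [inner_ξ, η_φ] at h1
  simp only [FiberBundle.extend_apply_self, zero_apply] at h2
  simp
  linarith

/-- On a contact metric manifold `∇_v ξ = -φ v - φ h v`: the symmetric part of `∇ξ` comes from
`inner_cov_ξ_φ`, the skew part from `inner_cov_ξ_sub`. -/
lemma cov_ξ (hc : IsLeviCivita S.g cov) (v : TangentSpace (𝓡 (2 * n + 1)) x) :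
    cov S.ξ x v = - S.φ x v - S.φ x (S.hEnd x v) := by
  refine ext_inner S.g fun u ↦ ?_
  have h1 := S.inner_cov_ξ_φ hc u (S.φ x v)
  have h2 := S.inner_cov_ξ_sub hc u v
  have h3 := S.inner_cov_ξ_sub hc u (S.ξ x)
  rw [S.cov_ξ_ξ hc, S.φ_ξ] at h3
  rw [φ_φ, hEnd_φ] at h1
  simp only [map_add, map_neg, map_smul, map_zero, zero_apply, S.cov_ξ_ξ hc, smul_eq_mul, map_sub,
    sub_apply, neg_apply] at h1 h2 h3 ⊢
  rw [S.g.symm x _ u, S.g.symm x _ u, S.g.symm x _ u]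
  rw [S.g.symm x _ u] at h2
  rw [show S.g.inner x (cov S.ξ x u) (S.ξ x) = 0 by linarith] at h1
  linarith

/-- `h` is self-adjoint, because `φ h` is the negative of the symmetric part of `∇ξ`. -/
lemma inner_hEnd_right (u v : TangentSpace (𝓡 (2 * n + 1)) x) :
    S.g.inner x u (S.hEnd x v) = S.g.inner x (S.hEnd x u) v := by
  have h1 := S.inner_cov_ξ_sub (isLeviCivita_leviCivita S.g) (S.φ x u) v
  rw [S.cov_ξ (isLeviCivita_leviCivita S.g), S.cov_ξ (isLeviCivita_leviCivita S.g), hEnd_φ,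
    map_neg, φ_φ, φ_φ, η_hEnd] at h1
  rw [S.g.symm x (- S.φ x v - _)] at h1
  simp only [map_add, map_neg, map_smul, map_sub, add_apply, neg_apply, smul_apply, sub_apply,
    smul_eq_mul, inner_φ_right, φ_φ, inner_ξ, η_hEnd, zero_smul, add_zero] at h1
  linarith

/-! ### The Jacobi operator of the Reeb field -/

lemma η_proj (v : TangentSpace (𝓡 (2 * n + 1)) x) : S.η x (S.proj x v) = 0 := by
  simp [proj_apply, S.η_ξ]

lemma φ_φ_eq (v : TangentSpace (𝓡 (2 * n + 1)) x) : S.φ x (S.φ x v) = - S.proj x v := by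
  rw [φ_φ, proj_apply]; abel

lemma φ_proj (v : TangentSpace (𝓡 (2 * n + 1)) x) : S.φ x (S.proj x v) = S.φ x v := by
  simp [proj_apply, S.φ_ξ]

lemma hEnd_proj (v : TangentSpace (𝓡 (2 * n + 1)) x) : S.hEnd x (S.proj x v) = S.hEnd x v := by
  simp [proj_apply, S.hEnd_ξ]

lemma proj_φ (v : TangentSpace (𝓡 (2 * n + 1)) x) : S.proj x (S.φ x v) = S.φ x v := by
  simp [proj_apply, S.η_φ]

lemma proj_hEnd (v : TangentSpace (𝓡 (2 * n + 1)) x) : S.proj x (S.hEnd x v) = S.hEnd x v := by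
  simp [proj_apply, S.η_hEnd]

lemma proj_proj (v : TangentSpace (𝓡 (2 * n + 1)) x) : S.proj x (S.proj x v) = S.proj x v := by
  rw [proj_apply _ (S.proj x v), η_proj, zero_smul, sub_zero]

/-- The Lie derivative of `P h = h`, where `P = Id - η ⊗ ξ`. -/
lemma proj_lieh (v : TangentSpace (𝓡 (2 * n + 1)) x) : S.proj x (S.lieh x v) = S.lieh x v := by
  have h := S.isLieDeriv_proj.comp S.smooth_ξ S.smoothEnd_proj S.smoothEnd_hEnd S.isLieDeriv_hEnd
  have e : (fun x ↦ S.proj x ∘L S.hEnd x) = S.hEnd := by ext x v; exact S.proj_hEnd v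
  rw [e] at h
  simpa using congrArg (fun T ↦ T x v) (h.unique S.isLieDeriv_hEnd)

/-- The Lie derivative of the identity `h φ + φ h = 0`. -/
lemma φ_lieh_add (v : TangentSpace (𝓡 (2 * n + 1)) x) :
    S.φ x (S.lieh x v) + S.lieh x (S.φ x v) = (-4 : ℝ) • S.hEnd x (S.hEnd x v) := by
  have h1 := S.isLieDeriv_φ.comp S.smooth_ξ S.smoothEnd_φ S.smoothEnd_hEnd S.isLieDeriv_hEnd
  have h2 := S.isLieDeriv_hEnd.comp S.smooth_ξ S.smoothEnd_hEnd S.smoothEnd_φ S.isLieDeriv_φ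
  have e : (fun x ↦ S.hEnd x ∘L S.φ x) = fun x ↦ (-1 : ℝ) • (S.φ x ∘L S.hEnd x) := by
    ext x v; simp [S.hEnd_φ]
  rw [e] at h2
  have h3 := congrArg (fun T ↦ T x v)
    (h2.unique (h1.smul (-1) (S.smoothEnd_φ.comp S.smoothEnd_hEnd)))
  simp only [add_apply, ContinuousLinearMap.comp_apply, smul_apply, map_smul] at h3
  linear_combination (norm := module) h3

/-- The Jacobi operator of the Reeb field of any contact metric structure,
`R(X, ξ)ξ = X - η(X) ξ + 2 h X + h² X + φ (L_ξ h) X`. -/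
lemma curvature_ξ_ξ (hX : SmoothFieldAt (𝓡 (2 * n + 1)) X x) :
    curvature (leviCivita S.g) X S.ξ S.ξ x = S.proj x (X x) + (2 : ℝ) • S.hEnd x (X x)
      + S.hEnd x (S.hEnd x (X x)) + S.φ x (S.lieh x (X x)) := by
  have hc := isLeviCivita_leviCivita S.g
  set cov := leviCivita S.g
  have hφh := S.smoothEnd_φ.comp S.smoothEnd_hEnd
  have hB := (S.smoothEnd_φ.smul (-1)).add (hφh.smul (-1))
  -- since `B ξ = 0`, `R(X, ξ)ξ = -∇_ξ (B X) - B [X, ξ] = -(L_ξ B) X - B² X` for `B = ∇ξ`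
  have hL := ((S.isLieDeriv_φ.smul (-1) S.smoothEnd_φ).add (S.smoothEnd_φ.smul (-1))
    (hφh.smul (-1)) ((S.isLieDeriv_φ.comp S.smooth_ξ S.smoothEnd_φ S.smoothEnd_hEnd
      S.isLieDeriv_hEnd).smul (-1) hφh)) hX.mdiffAt
  have hBX := hB.mdiffAt hX.mdiffAt
  have e0 : (fun y ↦ cov S.ξ y (S.ξ y)) = 0 := funext fun y ↦ S.cov_ξ_ξ hc
  have e1 : (fun y ↦ cov S.ξ y (X y)) = fun y ↦ ((-1 : ℝ) • S.φ y +
      (-1 : ℝ) • (S.φ y ∘L S.hEnd y)) (X y) := by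
    funext y
    rw [S.cov_ξ hc]
    simp [sub_eq_add_neg]
  have e2 := hc.torsion_free (S.smooth_ξ x).mdiffAt hBX
  rw [lieDerivEnd] at hL
  rw [curvature, e0, e1, CovariantDerivative.zero, eq_add_of_sub_eq e2, eq_add_of_sub_eq hL,
    mlieBracket_swap_apply, S.cov_ξ hc, S.cov_ξ hc]
  simp only [add_apply, smul_apply, ContinuousLinearMap.comp_apply, map_add, map_smul, map_neg,
    Pi.zero_apply, zero_apply, S.hEnd_φ, S.φ_φ_eq, S.proj_hEnd]
  module

/-! ### Weakly `(κ, μ)`-structures -/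

section Weak

variable {S} {κ μ : ℝ}

lemma IsWeaklyKappaMu.φ_lieh (hS : S.IsWeaklyKappaMu κ μ)
    (v : TangentSpace (𝓡 (2 * n + 1)) x) :
    S.φ x (S.lieh x v) = (κ - 1) • S.proj x v + (μ - 2) • S.hEnd x v
      - S.hEnd x (S.hEnd x v) := by
  have hX := smoothFieldAt_extend v
  have h := hS _ x hX
  rw [S.curvature_ξ_ξ hX, S.h_eq_hEnd hX.mdiffAt] at h
  simp only [FiberBundle.extend_apply_self, ← proj_apply] at h
  linear_combination (norm := module) h

/-- `φ` applied to `φ_lieh`, using `-φ² (L_ξ h) = L_ξ h`. -/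
lemma IsWeaklyKappaMu.lieh_eq_add (hS : S.IsWeaklyKappaMu κ μ)
    (v : TangentSpace (𝓡 (2 * n + 1)) x) :
    S.lieh x v = (1 - κ) • S.φ x v + (2 - μ) • S.φ x (S.hEnd x v)
      + S.φ x (S.hEnd x (S.hEnd x v)) := by
  have h := congrArg (S.φ x) (hS.φ_lieh v)
  simp only [φ_φ_eq, proj_lieh, map_add, map_sub, map_smul, φ_proj] at h
  linear_combination (norm := module) (-1 : ℝ) • h

/-- On a weakly `(κ, μ)`-space `h² = (1 - κ) (Id - η ⊗ ξ)`. -/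
lemma IsWeaklyKappaMu.hEnd_hEnd (hS : S.IsWeaklyKappaMu κ μ)
    (v : TangentSpace (𝓡 (2 * n + 1)) x) :
    S.hEnd x (S.hEnd x v) = (1 - κ) • S.proj x v := by
  have h := S.φ_lieh_add v
  rw [hS.φ_lieh, hS.lieh_eq_add] at h
  simp only [hEnd_φ, φ_φ_eq, map_neg, proj_hEnd] at h
  linear_combination (norm := module) (1 / 2 : ℝ) • h

/-- On a weakly `(κ, μ)`-space `L_ξ h = (2 - μ) φ h + 2 (1 - κ) φ`. -/
lemma IsWeaklyKappaMu.lieh_eq (hS : S.IsWeaklyKappaMu κ μ)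
    (v : TangentSpace (𝓡 (2 * n + 1)) x) :
    S.lieh x v = (2 - μ) • S.φ x (S.hEnd x v) + (2 * (1 - κ)) • S.φ x v := by
  rw [hS.lieh_eq_add, hS.hEnd_hEnd, map_smul, φ_proj]
  module

end Weak

lemma inner_proj_self (v : TangentSpace (𝓡 (2 * n + 1)) x) :
    S.g.inner x v (S.proj x v) = S.g.inner x v v - S.η x v ^ 2 := by
  rw [proj_apply, map_sub, map_smul, S.g.symm x v (S.ξ x), inner_ξ, smul_eq_mul, sq]

lemma inner_proj_left (u v : TangentSpace (𝓡 (2 * n + 1)) x) :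
    S.g.inner x (S.proj x u) v = S.g.inner x u (S.proj x v) := by
  rw [proj_apply, proj_apply, map_sub, map_sub, map_smul, map_smul, S.g.symm x u (S.ξ x)]
  simp [inner_ξ, mul_comm]

lemma inner_self_nonneg (v : TangentSpace (𝓡 (2 * n + 1)) x) : 0 ≤ S.g.inner x v v := by
  rcases eq_or_ne v 0 with rfl | h
  · simp
  · exact (S.g.pos x v h).le

lemma inner_proj_self_nonneg (v : TangentSpace (𝓡 (2 * n + 1)) x) :
    0 ≤ S.g.inner x v (S.proj x v) := by
  rw [← S.proj_proj, ← inner_proj_left]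
  exact S.inner_self_nonneg _

/-- A weakly `(κ, μ)`-structure that is not K-contact has `κ < 1`. -/
lemma IsWeaklyKappaMu.lt_one {S : ContactMetricStructure n M} {κ μ : ℝ}
    (hS : S.IsWeaklyKappaMu κ μ) (hK : ¬ S.IsKContact) : κ < 1 := by
  by_contra! hκ
  refine hK fun X x hX ↦ ?_
  rw [S.h_eq_hEnd hX.mdiffAt]
  by_contra hne
  have h1 := S.g.pos x _ hne
  rw [← S.inner_hEnd_right, hS.hEnd_hEnd, map_smul, smul_eq_mul] at h1
  nlinarith [S.inner_proj_self_nonneg (X x)]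

/-- If `h² = s² (Id - η ⊗ ξ)`, the eigenvalues of `h` are bounded by `s`. -/
lemma abs_inner_hEnd_le {s : ℝ} (hs : 0 < s)
    (hh : ∀ v : TangentSpace (𝓡 (2 * n + 1)) x, S.hEnd x (S.hEnd x v) = s ^ 2 • S.proj x v)
    (v : TangentSpace (𝓡 (2 * n + 1)) x) :
    |S.g.inner x v (S.hEnd x v)| ≤ s * S.g.inner x v (S.proj x v) := by
  have key : ∀ t : ℝ, S.g.inner x (S.hEnd x v + t • S.proj x v) (S.hEnd x v + t • S.proj x v)
      = (s ^ 2 + t ^ 2) * S.g.inner x v (S.proj x v) + 2 * t * S.g.inner x v (S.hEnd x v) := by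
    intro t
    simp only [map_add, map_smul, add_apply, smul_apply, smul_eq_mul, ← inner_hEnd_right, hh,
      inner_proj_left, proj_proj, proj_hEnd, hEnd_proj]
    ring
  have h1 := S.inner_self_nonneg (S.hEnd x v + s • S.proj x v)
  have h2 := S.inner_self_nonneg (S.hEnd x v + (-s) • S.proj x v)
  rw [key] at h1 h2
  rw [abs_le]
  constructor <;> nlinarith

/-! ### The deformed structure -/

/-- The bilinear form `g(p h u + q (u - η(u) ξ), v) + η(u) η(v)`. -/
def deformInner (p q : ℝ) (x : M) : TangentSpace (𝓡 (2 * n + 1)) x →L[ℝ]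
    TangentSpace (𝓡 (2 * n + 1)) x →L[ℝ] ℝ :=
  S.g.inner x ∘L (p • S.hEnd x + q • S.proj x) + (S.η x).smulRight (S.η x)

lemma deformInner_apply (p q : ℝ) (u v : TangentSpace (𝓡 (2 * n + 1)) x) :
    S.deformInner p q x u v = p * S.g.inner x u (S.hEnd x v) + q * S.g.inner x u (S.proj x v)
      + S.η x u * S.η x v := by
  simp [deformInner, inner_hEnd_right, inner_proj_left]

/-- A uniform lower bound for the deformed metric, which gives definiteness as well as the
compatibility with the topology of the tangent spaces. -/
lemma exists_deformInner_ge {p q s : ℝ} (hs : 0 < s) (hq : 0 < q) (hpq : q ^ 2 - s ^ 2 * p ^ 2 = 1)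
    (hh : ∀ (x : M) (v : TangentSpace (𝓡 (2 * n + 1)) x),
      S.hEnd x (S.hEnd x v) = s ^ 2 • S.proj x v) :
    ∃ ε > 0, ∀ (x : M) (v : TangentSpace (𝓡 (2 * n + 1)) x),
      ε * S.g.inner x v v ≤ S.deformInner p q x v v := by
  have hlt : |p| * s < q := by
    refine lt_of_pow_lt_pow_left₀ 2 hq.le ?_
    rw [mul_pow, sq_abs]
    nlinarith
  refine ⟨min (q - |p| * s) 1, lt_min (by linarith) one_pos, fun x v ↦ ?_⟩
  have h1 := S.abs_inner_hEnd_le hs (hh x) v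
  have h2 := S.inner_proj_self v
  have h3 := S.inner_proj_self_nonneg v
  have h4 : -(|p| * (s * S.g.inner x v (S.proj x v))) ≤ p * S.g.inner x v (S.hEnd x v) := by
    refine le_trans (neg_le_neg (mul_le_mul_of_nonneg_left h1 (abs_nonneg p))) ?_
    rw [← abs_mul]
    exact neg_abs_le _
  have h5 := mul_le_mul_of_nonneg_right (min_le_left (q - |p| * s) 1) h3
  have h6 := mul_le_mul_of_nonneg_right (min_le_right (q - |p| * s) 1) (sq_nonneg (S.η x v))
  rw [deformInner_apply, show S.g.inner x v v = S.g.inner x v (S.proj x v) + S.η x v ^ 2 by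
    linarith]
  linarith

lemma contMDiff_deformInner (p q : ℝ) :
    ContMDiff (𝓡 (2 * n + 1)) ((𝓡 (2 * n + 1)).prod 𝓘(ℝ, EuclideanSpace ℝ (Fin (2 * n + 1)) →L[ℝ]
      EuclideanSpace ℝ (Fin (2 * n + 1)) →L[ℝ] ℝ)) ∞
      (fun x ↦ TotalSpace.mk' (EuclideanSpace ℝ (Fin (2 * n + 1)) →L[ℝ]
        EuclideanSpace ℝ (Fin (2 * n + 1)) →L[ℝ] ℝ)
        (E := fun x : M ↦ TangentSpace (𝓡 (2 * n + 1)) x →L[ℝ]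
          TangentSpace (𝓡 (2 * n + 1)) x →L[ℝ] ℝ) x (S.deformInner p q x)) := by
  have hQ := (S.smoothEnd_hEnd.smul p).add (S.smoothEnd_proj.smul q)
  refine contMDiff_hom_of_apply (V := fun x : M ↦ TangentSpace (𝓡 (2 * n + 1)) x →L[ℝ] ℝ)
    fun X x hX ↦ ?_
  exact ContMDiffAt.add_section
    (V := fun x : M ↦ TangentSpace (𝓡 (2 * n + 1)) x →L[ℝ] ℝ)
    (ContMDiffAt.clm_bundle_apply (F₁ := EuclideanSpace ℝ (Fin (2 * n + 1)))
      (ϕ := S.g.inner) (v := fun y ↦ (p • S.hEnd y + q • S.proj y) (X y))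
      (E₂ := fun x : M ↦ TangentSpace (𝓡 (2 * n + 1)) x →L[ℝ] ℝ)
      (S.g.contMDiff x) (hQ.smoothFieldAt hX))
    ((S.contMDiffAt_η hX).smul_section (S.smooth_η x))

/-- The Riemannian metric `g₁ = g((p h + q P) ·, ·) + η ⊗ η`, where `P = Id - η ⊗ ξ`. It is positive
because `h² = s² P` and `|p| s < q`. -/
def deformMetric {p q s : ℝ} (hs : 0 < s) (hq : 0 < q) (hpq : q ^ 2 - s ^ 2 * p ^ 2 = 1)
    (hh : ∀ (x : M) (v : TangentSpace (𝓡 (2 * n + 1)) x),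
      S.hEnd x (S.hEnd x v) = s ^ 2 • S.proj x v) :
    ContMDiffRiemannianMetric (𝓡 (2 * n + 1)) ∞ (EuclideanSpace ℝ (Fin (2 * n + 1)))
      (TangentSpace (𝓡 (2 * n + 1)) : M → Type _) where
  inner := S.deformInner p q
  symm x u v := by
    rw [deformInner_apply, deformInner_apply, inner_hEnd_right, S.g.symm x _ v,
      ← inner_proj_left, S.g.symm x _ v]
    ring
  pos x v hv := by
    obtain ⟨ε, hε, h⟩ := S.exists_deformInner_ge hs hq hpq hh
    exact (mul_pos hε (S.g.pos x v hv)).trans_le (h x v)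
  isVonNBounded x := by
    obtain ⟨ε, hε, h⟩ := S.exists_deformInner_ge hs hq hpq hh
    have h0 : √ε ≠ 0 := (Real.sqrt_pos.mpr hε).ne'
    refine ((S.g.isVonNBounded x).image
      ((√ε)⁻¹ • ContinuousLinearMap.id ℝ (TangentSpace (𝓡 (2 * n + 1)) x))).subset fun v hv ↦ ?_
    refine ⟨√ε • v, ?_, by simp [smul_smul, h0]⟩
    have h1 : √ε * (√ε * S.g.inner x v v) = ε * S.g.inner x v v := by
      rw [← mul_assoc, Real.mul_self_sqrt hε.le]
    simpa [h1] using (h x v).trans_lt hv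
  contMDiff := S.contMDiff_deformInner p q

/-- The contact metric structure with the same `η` and `ξ`, and with `φ₁ = p φ h + q φ`. -/
def deform {p q s : ℝ} (hs : 0 < s) (hq : 0 < q) (hpq : q ^ 2 - s ^ 2 * p ^ 2 = 1)
    (hh : ∀ (x : M) (v : TangentSpace (𝓡 (2 * n + 1)) x),
      S.hEnd x (S.hEnd x v) = s ^ 2 • S.proj x v) : ContactMetricStructure n M where
  η := S.η
  ξ := S.ξ
  φ := fun x ↦ p • (S.φ x ∘L S.hEnd x) + q • S.φ x
  g := S.deformMetric hs hq hpq hh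
  smooth_η := S.smooth_η
  smooth_ξ := S.smooth_ξ
  smooth_φ := ((S.smoothEnd_φ.comp S.smoothEnd_hEnd).smul p).add (S.smoothEnd_φ.smul q)
  contact := S.contact
  η_ξ := S.η_ξ
  unit_ξ x := by
    change S.deformInner p q x (S.ξ x) (S.ξ x) = 1
    simp [deformInner_apply, hEnd_ξ, proj_apply, S.η_ξ]
  φ_φ x v := by
    have e : -v + S.η x v • S.ξ x = -(q ^ 2 - s ^ 2 * p ^ 2) • S.proj x v := by
      rw [hpq, proj_apply]; module
    rw [e]
    simp only [add_apply, smul_apply, ContinuousLinearMap.comp_apply, map_add, map_smul, map_neg,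
      hEnd_φ, φ_φ_eq, hh, proj_hEnd, proj_proj]
    module
  φ_ξ x := by simp [hEnd_ξ, S.φ_ξ]
  dη_eq X Y x hX hY := by
    rw [S.dη_eq X Y x hX hY]
    change _ = 2 * S.deformInner p q x (X x) _
    have e : S.φ x (Y x) = (q ^ 2 - s ^ 2 * p ^ 2) • S.φ x (Y x) := by rw [hpq, one_smul]
    rw [e, deformInner_apply]
    simp only [add_apply, smul_apply, ContinuousLinearMap.comp_apply, map_add, map_smul, map_neg,
      hEnd_φ, hh, proj_φ, φ_proj, η_φ, smul_eq_mul]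
    ring

section

variable {κ μ p q s : ℝ} {S} (hs : 0 < s) (hq : 0 < q) (hpq : q ^ 2 - s ^ 2 * p ^ 2 = 1)
    (hh : ∀ (x : M) (v : TangentSpace (𝓡 (2 * n + 1)) x),
      S.hEnd x (S.hEnd x v) = s ^ 2 • S.proj x v)

/-- On a weakly `(κ, μ)`-space the deformed structure has `h₁` proportional to `h`. -/
lemma IsWeaklyKappaMu.hEnd_deform (hS : S.IsWeaklyKappaMu κ μ) :
    (S.deform hs hq hpq hh).hEnd = fun x ↦ (q - (1 - μ / 2) * p) • S.hEnd x := by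
  have hφh := S.smoothEnd_φ.comp S.smoothEnd_hEnd
  have h1 := ((S.isLieDeriv_φ.comp S.smooth_ξ S.smoothEnd_φ S.smoothEnd_hEnd
    S.isLieDeriv_hEnd).smul p hφh).add (hφh.smul p) (S.smoothEnd_φ.smul q)
    (S.isLieDeriv_φ.smul q S.smoothEnd_φ)
  have h2 := (S.deform hs hq hpq hh).isLieDeriv_φ.unique h1
  ext1 x
  ext1 v
  have h3 := congrArg (fun T ↦ T x v) h2
  simp only [add_apply, smul_apply, ContinuousLinearMap.comp_apply, hS.lieh_eq, map_add, map_smul,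
    hS.hEnd_hEnd, φ_φ_eq, proj_hEnd] at h3
  simp only [smul_apply]
  linear_combination (norm := module) (1 / 2 : ℝ) • h3

lemma IsWeaklyKappaMu.lieh_deform (hS : S.IsWeaklyKappaMu κ μ) :
    (S.deform hs hq hpq hh).lieh = fun x ↦ (q - (1 - μ / 2) * p) • S.lieh x := by
  have h := (S.deform hs hq hpq hh).isLieDeriv_hEnd
  rw [hS.hEnd_deform] at h
  exact h.unique (S.isLieDeriv_hEnd.smul _ S.smoothEnd_hEnd)

end

end ContactMetricStructure

end

theorem mainTheorem2 (n : ℕ) (M : Type*) [TopologicalSpace M] [T2Space M]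
    [ChartedSpace (EuclideanSpace ℝ (Fin (2 * n + 1))) M] [IsManifold (𝓡 (2 * n + 1)) ∞ M]
    (S : ContactMetricStructure n M) (κ μ : ℝ)
    (hS : S.IsWeaklyKappaMu κ μ) (hK : ¬ S.IsKContact) (hI : |boeckxInvariant κ μ| < 1) :
    ∃ S₁ : ContactMetricStructure n M,
      S₁.η = S.η ∧ S₁.ξ = S.ξ ∧
      (∀ (X : Π x : M, TangentSpace (𝓡 (2 * n + 1)) x) (x : M), SmoothFieldAt (𝓡 (2 * n + 1)) X x →
        S₁.φ x (X x) =
          (1 / (2 * √(1 - κ) * √(1 - κ - (1 - μ / 2) ^ 2))) • lieDerivEnd S.ξ S.h X x) ∧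
      S₁.IsWeaklyKappaMu (κ + (1 - μ / 2) ^ 2) 2 := by
  have hκ : 0 < 1 - κ := sub_pos.mpr (hS.lt_one hK)
  set s := √(1 - κ) with hs_def
  have hs : 0 < s := Real.sqrt_pos.mpr hκ
  have hs2 : s ^ 2 = 1 - κ := Real.sq_sqrt hκ.le
  set a := 1 - μ / 2 with ha_def
  have hd2 : 0 < 1 - κ - a ^ 2 := by
    rw [boeckxInvariant, abs_div, abs_of_pos hs, div_lt_one hs] at hI
    have := pow_lt_pow_left₀ hI (abs_nonneg a) two_ne_zero
    rw [sq_abs, hs2] at this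
    rw [ha_def]
    linarith
  set d := √(1 - κ - a ^ 2) with hd_def
  have hd : 0 < d := Real.sqrt_pos.mpr hd2
  have hdd : d ^ 2 = s ^ 2 - a ^ 2 := by rw [hs2]; exact Real.sq_sqrt hd2.le
  have hμ : 2 - μ = 2 * a := by rw [ha_def]; ring
  -- expanding `L_ξ h` in the formula for `φ₁` gives `φ₁ = p φ h + q φ` with `p = a / (s d)`
  -- and `q = s / d`
  have hpq : (s / d) ^ 2 - s ^ 2 * (a / (s * d)) ^ 2 = 1 := by
    field_simp
    linarith
  have hh : ∀ (x : M) (v : TangentSpace (𝓡 (2 * n + 1)) x),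
      S.hEnd x (S.hEnd x v) = s ^ 2 • S.proj x v := fun x v ↦ by rw [hs2, hS.hEnd_hEnd]
  -- the factor `q - a p` of `h₁ = (q - a p) h`
  have hl : s / d - a * (a / (s * d)) = d / s := by
    field_simp
    linarith
  let S₁ := S.deform hs (div_pos hs hd) hpq hh
  have hφ : ∀ (x : M) (v : TangentSpace (𝓡 (2 * n + 1)) x),
      S₁.φ x v = (1 / (2 * s * d)) • S.lieh x v := by
    intro x v
    change (a / (s * d)) • S.φ x (S.hEnd x v) + (s / d) • S.φ x v = _
    rw [hS.lieh_eq, hμ, ← hs2, smul_add, smul_smul, smul_smul]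
    congr 2 <;> field_simp
  refine ⟨S₁, rfl, rfl, fun X x hX ↦ ?_, fun X x hX ↦ ?_⟩
  · rw [hφ, S.lieDerivEnd_h_eq hX]
  · rw [S₁.curvature_ξ_ξ hX, S₁.h_eq_hEnd hX.mdiffAt, ← S₁.proj_apply]
    have h1 : ∀ v, S₁.hEnd x v = (d / s) • S.hEnd x v := fun v ↦ by
      rw [hS.hEnd_deform hs (div_pos hs hd) hpq hh, ← ha_def, hl]; rfl
    have h2 : S₁.lieh x (X x) = (2 * d ^ 2) • S₁.φ x (X x) := by
      rw [hS.lieh_deform hs (div_pos hs hd) hpq hh, ← ha_def, hl, hφ, smul_smul, smul_apply]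
      congr 1
      field_simp
    have h3 : S₁.hEnd x (S₁.hEnd x (X x)) = d ^ 2 • S₁.proj x (X x) := by
      rw [h1, h1, map_smul, hh, smul_smul, smul_smul]
      change _ = d ^ 2 • S.proj x (X x)
      congr 1
      field_simp
    have h4 : κ + a ^ 2 = 1 - d ^ 2 := by rw [hdd, hs2]; ring
    rw [h2, h3, map_smul, S₁.φ_φ_eq, h4]
    module
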